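/- Let $l\le 0$ and $u\ge 1$ be integers, $D_{l,u}=\{a\in\mathbb Z\mid l\le a\le u\}$, let $w$ be the unique integer with $2^{w-1}\le u-l+1<2^w$, and let $d\ge 0$ be an integer (the dimension). Let $\mathsf{unique}=\{a\in D_{l,u}\mid u-2^{w-1}<a<l+2^{w-1}\}$, $\mathsf{nonunique}=D_{l,u}\setminus\mathsf{unique}$ and $\mathsf{upper}=\{a\in D_{l,u}\mid u-2^{w-1}<a\le u\}$. An asymmetric joint sparse form (AJSF) of $n\in\mathbb Z^d$ with digit set $D_{l,u}$ is a sequence $(\varepsilon_j)_{j\ge 0}$ of columns $\varepsilon_j\in D_{l,u}^d$, only finitely many of them nonzero, with $n=\sum_j\varepsilon_j2^j$, such that for all $j$: 1. $\varepsilon_j$ is $0$ or contains an odd digit; 2. if $\varepsilon_j\ne 0$, then $\varepsilon_{j+1}=\dots=\varepsilon_{j+w-2}=0$; 3. if $\varepsilon_j\neq 0$ and $\varepsilon_{j+w-1}\ne 0$, then (a) there is an $i\in\{1,\dots,d\}$ such that $\varepsilon_{j+w-1,i}$ is odd and $\varepsilon_{j,i}\in\mathsf{unique}$; (b) for every $i$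 with $\varepsilon_{j,i}\in\mathsf{nonunique}$, $\varepsilon_{j+w-1,i}\not\equiv u+1 \pmod{2^{w-1}}$; (c) for every $i$ with $\varepsilon_{j,i}\in\mathsf{upper}\cap\mathsf{nonunique}$, $\varepsilon_{j+w-1,i}\equiv u\pmod{2^{w-1}}$. Its Hamming weight is the number of nonzero columns $\varepsilon_j$. A joint binary expansion of a vector $n$ of nonnegative integers is a finite word of columns in $\{0,1\}^d$ with value $n$, leading zero columns being allowed. Theorem. There is a deterministic transducer with a complete transition function, which reads one column of $\{0,1\}^d$ and writes one letter of $\{0,1\}$ in each transition, such that: - it has fewer than $8^dw$ states; - it has exactly one final state, which is also its initial state; - it computes the Hamming weight of the AJSF: every vector $n\in\mathbb Z^d$ with nonnegative entries has an AJSF with digit set $D_{l,u}$, and whenever the transducer, started in its initial state, reads a joint binary expansion of $n$ from right to left (least significant column first) and stops in the final state, the number of $1$s in its output is the Hamming weight of every AJSF of $n$; - the word $0^{4w}$ ($4w$ zero columns) is a reset sequence leading to the initial and final state: from every state, reading $0^{4w}$ leads to that state. (Hence every joint binary expansion, extended by $4w$ leading zero columns, is read on a path that ends in the final state.) -/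

import Mathlib

/-- The digits of `D_{l,u} = {a ∈ ℤ | l ≤ a ≤ u}` that are alone in their residue class
modulo `2 ^ (w - 1)`. -/
def uniqueDigits (l u : ℤ) (w : ℕ) : Set ℤ :=
  {a | a ∈ Set.Icc l u ∧ u - 2 ^ (w - 1) < a ∧ a < l + 2 ^ (w - 1)}

/-- The remaining digits of `D_{l,u}`. -/
def nonuniqueDigits (l u : ℤ) (w : ℕ) : Set ℤ :=
  Set.Icc l u \ uniqueDigits l u w

/-- The upper digits of `D_{l,u}`. -/
def upperDigits (l u : ℤ) (w : ℕ) : Set ℤ :=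
  {a | a ∈ Set.Icc l u ∧ u - 2 ^ (w - 1) < a ∧ a ≤ u}

/-- A digit expansion in dimension `d`, up to leading zeros: `ε j` is the column at position `j`
(position `0` is the least significant one), and only finitely many columns are nonzero. -/
abbrev JointExpansion (d : ℕ) : Type := ℕ →₀ (Fin d → ℤ)

namespace JointExpansion

/-- The integer vector `∑ j, ε j * 2 ^ j` represented by a joint expansion. -/
def value {d : ℕ} (ε : JointExpansion d) : Fin d → ℤ :=
  fun i => ∑ j ∈ ε.support, ε j i * 2 ^ j

/-- The Hamming weight: the number of nonzero columns. -/
def hammingWeight {d : ℕ} (ε : JointExpansion d) : ℕ :=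
  ε.support.card

end JointExpansion

/-- `ε` is the asymmetric joint sparse form of `n` with digit set `D_{l,u}`. -/
structure IsAJSF {d : ℕ} (l u : ℤ) (w : ℕ) (n : Fin d → ℤ) (ε : JointExpansion d) : Prop where
  digit_mem : ∀ j i, ε j i ∈ Set.Icc l u
  value_eq : ε.value = n
  zero_or_odd : ∀ j, ε j = 0 ∨ ∃ i, Odd (ε j i)
  sparse : ∀ j, ε j ≠ 0 → ∀ k, j + 1 ≤ k → k ≤ j + w - 2 → ε k = 0
  exists_odd_unique : ∀ j, ε j ≠ 0 → ε (j + w - 1) ≠ 0 →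
    ∃ i, Odd (ε (j + w - 1) i) ∧ ε j i ∈ uniqueDigits l u w
  nonunique_not_modEq : ∀ j, ε j ≠ 0 → ε (j + w - 1) ≠ 0 →
    ∀ i, ε j i ∈ nonuniqueDigits l u w → ¬ ε (j + w - 1) i ≡ u + 1 [ZMOD 2 ^ (w - 1)]
  upper_nonunique_modEq : ∀ j, ε j ≠ 0 → ε (j + w - 1) ≠ 0 →
    ∀ i, ε j i ∈ upperDigits l u w ∩ nonuniqueDigits l u w →
      ε (j + w - 1) i ≡ u [ZMOD 2 ^ (w - 1)]

/-- A deterministic transducer with complete transition function, input alphabet `α`, output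
alphabet `β` and state set `σ`: each transition reads one input letter and writes one output
letter. -/
structure Transducer (α β σ : Type) where
  step : σ → α → σ
  out : σ → α → β
  initial : σ
  final : Set σ

namespace Transducer

variable {α β σ : Type}

/-- The state reached from the given state by reading a word. The head of the list is the letter
that is read first. -/
def run (T : Transducer α β σ) : σ → List α → σ
  | s, [] => s
  | s, a :: x => T.run (T.step s a) x

/-- The word written while reading a word from the given state. The head of the list is the letter
that is written first. -/
def output (T : Transducer α β σ) : σ → List α → List β
  | _, [] => []
  | s, a :: x => T.out s a :: T.output (T.step s a) x

/-- `x` is a reset sequence leading to `s`. -/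
def IsResetSequenceTo (T : Transducer α β σ) (x : List α) (s : σ) : Prop :=
  ∀ t, T.run t x = s

end Transducer

/-- The vector whose joint binary expansion (leading zeros allowed) is the given word of columns.
The expansion is read from right to left, so the head of the list is the least significant
column. -/
def binaryValue {d : ℕ} (x : List (Fin d → Fin 2)) : Fin d → ℕ :=
  fun i => Nat.ofDigits 2 (x.map fun e => (e i : ℕ))

/-! Write `w = v + 2`, `M = 2 ^ (v + 1)`, `L = -l` and `u - l + 1 = M + K` with `0 ≤ K < M`. A digit
is `ρ - L + M * δ` with `0 ≤ ρ < M`, where `δ = 0`, or `δ = 1` and `ρ < K`; it is unique exactly if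
`K ≤ ρ`. When a nonzero column is written, the choice of `δ` at nonunique digits is postponed: the
tentative value assumes `δ = 0`, and a flag records that the true value may be one less.

If every unflagged component is even, the next column must be zero, and flagged components can be
made even. Otherwise the next column is nonzero. Modulo `M`, conditions 3(b) and 3(c) forbid the
residue `ρ = K` at a flagged component and permit decreasing the value only if `ρ = K - 1` results,
so the decrease happens exactly when the tentative residue is `K`. Hence tentative values and flags
evolve deterministically and determine the weight (`isTail_of_idle`, `IsTail.exists_cons`,
`IsTail.cons_of_block`, `isTail_weight`).

The new value `(m + L) / M` and the new flag `(m + L) % M < K + b`, with `b` the old flag, are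
computable bit by bit with carries at most 3 and one comparison bit per component
(`iterate_next_full`). This gives `(w - 1) * 8 ^ d` states. Small values are driven to zero
(`iterate_next_eq_zero`), which gives both the reset sequence and termination. -/

/-! ### The algorithm, one binary digit at a time -/

/-- The number added to the tentative value at position `t` of a block; over a whole block these
numbers add up to `L`. -/
def addend (v L : ℕ) (t : Fin (v + 1)) : ℕ :=
  if t = Fin.last v then L / 2 ^ v else L / 2 ^ (t : ℕ) % 2

/-- A configuration: the position inside a block of length `v + 1`, the remaining tentative values,
and the flags of a bitwise comparison, which at position `0` mark the components whose preceding
digit is not unique. -/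
abbrev Config (v d : ℕ) : Type := Fin (v + 1) × (Fin d → ℕ) × (Fin d → Bool)

namespace Config

variable {v d : ℕ}

/-- The next column is zero: every component that is not flagged is even. -/
def Idle (s : Config v d) : Prop := s.1 = 0 ∧ ∀ i, s.2.2 i = false → s.2.1 i % 2 = 0

/-- The bitwise comparison of the residues with `K`. -/
def compareBit (k p : ℕ) (b : Bool) : Bool := decide (p < k ∨ p = k ∧ b = true)

open Classical in
/-- One step of the digit expansion algorithm, which consumes one binary digit. -/
noncomputable def next (L K : ℕ) (s : Config v d) : Config v d :=
  if s.Idle then (0, fun i => s.2.1 i / 2, fun _ => false)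
  else (s.1 + 1, fun i => (s.2.1 i + addend v L s.1) / 2,
    fun i => compareBit (K / 2 ^ (s.1 : ℕ) % 2) ((s.2.1 i + addend v L s.1) % 2) (s.2.2 i))

open Classical in
/-- `1` if a nonzero column starts at the given configuration. -/
noncomputable def emit (s : Config v d) : Fin 2 := if s.1 = 0 ∧ ¬ s.Idle then 1 else 0

/-- The configuration that represents the zero vector. -/
def zero (v d : ℕ) : Config v d := (0, fun _ => 0, fun _ => false)

/-- The number of nonzero columns found in the first `N` steps. -/
noncomputable def weight (L K : ℕ) : ℕ → Config v d → ℕ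
  | 0, _ => 0
  | N + 1, s => (s.emit : ℕ) + weight L K N (s.next L K)

variable {L K : ℕ}

theorem idle_zero : (zero v d).Idle := ⟨rfl, fun _ _ => rfl⟩

theorem next_zero : (zero v d).next L K = zero v d := by
  rw [next, if_pos idle_zero]; simp [zero]

theorem iterate_next_zero (N : ℕ) : (next L K)^[N] (zero v d) = zero v d :=
  Function.iterate_fixed next_zero N

theorem weight_add (M N : ℕ) (s : Config v d) :
    weight L K (M + N) s = weight L K M s + weight L K N ((next L K)^[M] s) := by
  induction M generalizing s with
  | zero => simp [weight]
  | succ M ih => rw [Nat.succ_add, weight, weight, ih, Function.iterate_succ_apply, add_assoc]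

/-- A more significant bit decides the comparison unless the two bits agree. The term `b` makes the
inequality weak or strict, so the old flag serves as the initial value of the comparison. -/
theorem compareBit_spec {t r κ p k : ℕ} {b : Bool} (hr : r < 2 ^ t) (hκ : κ < 2 ^ t) :
    compareBit k p (decide (r < κ + b.toNat)) =
      decide (r + 2 ^ t * p < κ + 2 ^ t * k + b.toNat) := by
  have hb : b.toNat ≤ 1 := b.toNat_le
  simp only [compareBit, decide_eq_true_eq, decide_eq_decide]
  rcases lt_trichotomy p k with h | h | h
  · have := Nat.mul_le_mul_left (2 ^ t) (Nat.succ_le_of_lt h)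
    rw [Nat.mul_succ] at this
    constructor
    · intro; omega
    · intro; exact Or.inl h
  · subst h; constructor
    · rintro (h | h) <;> omega
    · intro h; right; exact ⟨rfl, by omega⟩
  · have := Nat.mul_le_mul_left (2 ^ t) (Nat.succ_le_of_lt h)
    rw [Nat.mul_succ] at this
    constructor
    · rintro (h | h) <;> omega
    · intro; omega

/-- Here `x` is the starting value plus the part of `L` already added, and `b` is the flag at the
start of the block. The position is reduced modulo `v + 1`, so that the last step of a block is
covered too. -/
theorem next_of_block {s : Config v d} (hs : ¬ s.Idle) {t : ℕ} (ht : s.1 = Fin.ofNat (v + 1) t)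
    (htv : t ≤ v) {x : Fin d → ℕ} {b : Fin d → Bool} (hq : ∀ i, s.2.1 i = x i / 2 ^ t)
    (hf : ∀ i, s.2.2 i = decide (x i % 2 ^ t < K % 2 ^ t + (b i).toNat)) :
    s.next L K = (Fin.ofNat (v + 1) (t + 1),
      fun i => (x i + 2 ^ t * addend v L s.1) / 2 ^ (t + 1),
      fun i => decide ((x i + 2 ^ t * addend v L s.1) % 2 ^ (t + 1) <
        K % 2 ^ (t + 1) + (b i).toNat)) := by
  have hval : (s.1 : ℕ) = t := by rw [ht]; simp [Fin.ofNat, Nat.mod_eq_of_lt (Nat.lt_succ_of_le htv)]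
  have hpos : 0 < 2 ^ t := by positivity
  have hdiv : ∀ i, (x i + 2 ^ t * addend v L s.1) / 2 ^ t = s.2.1 i + addend v L s.1 := fun i => by
    rw [Nat.add_mul_div_left _ _ hpos, hq]
  rw [next, if_neg hs]
  refine Prod.ext ?_ (Prod.ext ?_ ?_)
  · rw [ht]; ext; simp [Fin.ofNat, Fin.val_add]
  · funext i
    simp only
    rw [pow_succ, ← Nat.div_div_eq_div_mul, hdiv]
  · funext i
    simp only
    rw [hf, compareBit_spec (Nat.mod_lt _ hpos) (Nat.mod_lt _ hpos), Nat.mod_pow_succ,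
      Nat.mod_pow_succ (x := K), hdiv, Nat.add_mul_mod_self_left, hval]

theorem not_idle_iterate {s : Config v d} (hs : ¬ s.Idle) {t : ℕ}
    {y : (Fin d → ℕ) × (Fin d → Bool)} (h : (next L K)^[t] s = (Fin.ofNat (v + 1) t, y))
    (ht : t ≤ v) : ¬ ((next L K)^[t] s).Idle := by
  rcases t.eq_zero_or_pos with rfl | hpos
  · exact hs
  · rintro ⟨hi, -⟩
    rw [h, Fin.ext_iff, Fin.val_ofNat, Nat.mod_eq_of_lt (by omega)] at hi
    simp at hi; omega

/-- The configuration after `t` steps of a block. -/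
theorem iterate_next_block {s : Config v d} (h0 : s.1 = 0) (hs : ¬ s.Idle) (t : ℕ) (ht : t ≤ v) :
    (next L K)^[t] s = (Fin.ofNat (v + 1) t, fun i => (s.2.1 i + L % 2 ^ t) / 2 ^ t,
      fun i => decide ((s.2.1 i + L % 2 ^ t) % 2 ^ t < K % 2 ^ t + (s.2.2 i).toNat)) := by
  induction t with
  | zero =>
    obtain ⟨a, q, f⟩ := s
    simp only at h0; subst h0
    simp only [Function.iterate_zero, id_eq, pow_zero, Nat.mod_one, Nat.div_one, add_zero]
    refine Prod.ext (by simp) (Prod.ext rfl ?_)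
    -- Before any bit is read both residues are 0, and `0 < 0 + b` holds exactly if the flag is set.
    funext i
    cases h : f i <;> simp [h]
  | succ t ih =>
    have ih := ih (by omega)
    rw [Function.iterate_succ_apply']
    rw [next_of_block (x := fun i => s.2.1 i + L % 2 ^ t) (b := s.2.2)
      (not_idle_iterate hs ih (by omega)) (by rw [ih]) (by omega) (by rw [ih]; simp)
      (by rw [ih]; simp), ih]
    have hadd : 2 ^ t * addend v L (Fin.ofNat (v + 1) t) = 2 ^ t * (L / 2 ^ t % 2) := by
      have hne : Fin.ofNat (v + 1) t ≠ Fin.last v := by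
        rw [Ne, Fin.ext_iff, Fin.val_ofNat, Nat.mod_eq_of_lt (by omega), Fin.val_last]
        omega
      rw [addend, if_neg hne, Fin.val_ofNat, Nat.mod_eq_of_lt (show t < v + 1 by omega)]
    simp only [hadd, Nat.mod_pow_succ (x := L), add_assoc]

/-- The configuration after a whole block. -/
theorem iterate_next_full {s : Config v d} (h0 : s.1 = 0) (hs : ¬ s.Idle) (hK : K < 2 ^ (v + 1)) :
    (next L K)^[v + 1] s = (0, fun i => (s.2.1 i + L) / 2 ^ (v + 1),
      fun i => decide ((s.2.1 i + L) % 2 ^ (v + 1) < K + (s.2.2 i).toNat)) := by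
  have ih := iterate_next_block (L := L) (K := K) h0 hs v le_rfl
  rw [Function.iterate_succ_apply']
  rw [next_of_block (x := fun i => s.2.1 i + L % 2 ^ v) (b := s.2.2)
    (not_idle_iterate hs ih le_rfl) (by rw [ih]) le_rfl (by rw [ih]; simp)
    (by rw [ih]; simp), ih]
  have hadd : addend v L (Fin.ofNat (v + 1) v) = L / 2 ^ v := by
    rw [addend, if_pos]
    rw [Fin.ext_iff, Fin.val_ofNat, Nat.mod_eq_of_lt (by omega), Fin.val_last]
  refine Prod.ext ?_ (Prod.ext ?_ ?_)
  · ext; simp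
  all_goals simp only [hadd, add_assoc, Nat.mod_add_div, Nat.mod_eq_of_lt hK]

theorem weight_full {s : Config v d} (h0 : s.1 = 0) (hs : ¬ s.Idle) :
    weight L K (v + 1) s = 1 := by
  suffices h : ∀ t ≤ v, weight L K (t + 1) s = 1 from h v le_rfl
  intro t
  induction t with
  | zero => intro; simp [weight, emit, h0, hs]
  | succ t ih =>
    intro ht
    have := iterate_next_block (L := L) (K := K) h0 hs (t + 1) ht
    rw [weight_add, ih (by omega), this]
    simp only [weight, emit]
    rw [if_neg]
    · rfl
    · rintro ⟨h, -⟩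
      rw [Fin.ext_iff, Fin.val_ofNat, Nat.mod_eq_of_lt (by omega)] at h
      simp at h

end Config

/-! ### Bounds on the carries and return to zero -/

namespace Config

variable {v d L K : ℕ}

theorem addend_le (hL : L < 2 ^ (v + 2)) (t : Fin (v + 1)) : addend v L t ≤ 3 := by
  rw [addend]
  split_ifs
  · refine Nat.le_of_lt_succ (Nat.div_lt_of_lt_mul ?_)
    rw [pow_add] at hL; omega
  · omega

theorem next_le (hL : L < 2 ^ (v + 2)) {s : Config v d} (hs : ∀ i, s.2.1 i ≤ 3)
    (i : Fin d) : (s.next L K).2.1 i ≤ 3 := by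
  have := hs i
  have := addend_le hL s.1
  rw [next]
  split_ifs <;> simp only <;> omega

theorem exists_iterate_position_zero (hL : L < 2 ^ (v + 2)) (m : ℕ) (s : Config v d)
    (hm : (s.1 : ℕ) = 0 ∨ v + 1 ≤ s.1 + m) (hs : ∀ i, s.2.1 i ≤ 3) :
    ∃ k ≤ m, ((next L K)^[k] s).1 = 0 ∧ ∀ i, ((next L K)^[k] s).2.1 i ≤ 3 := by
  induction m generalizing s with
  | zero =>
    have := s.1.isLt
    exact ⟨0, le_rfl, Fin.ext (by rw [Function.iterate_zero, id, Fin.val_zero]; omega), hs⟩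
  | succ m ih =>
    by_cases h0 : s.1 = 0
    · exact ⟨0, Nat.zero_le _, h0, hs⟩
    · have hne : (s.1 : ℕ) ≠ 0 := fun h => h0 (Fin.ext h)
      obtain ⟨k, hk, h⟩ := ih (s.next L K) (by
        rw [next, if_neg (fun h => h0 h.1)]
        simp only [Fin.val_add_one]
        split_ifs <;> omega) (next_le hL hs)
      exact ⟨k + 1, by omega, h⟩

theorem exists_iterate_le {s : Config v d} {B C : ℕ} (hK : K < 2 ^ (v + 1)) (h0 : s.1 = 0)
    (hs : ∀ i, s.2.1 i ≤ B) (hBC : B / 2 ≤ C) (hLC : (B + L) / 2 ^ (v + 1) ≤ C) :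
    ∃ k ≤ v + 1, ((next L K)^[k] s).1 = 0 ∧ ∀ i, ((next L K)^[k] s).2.1 i ≤ C := by
  by_cases hi : s.Idle
  · refine ⟨1, by omega, ?_⟩
    rw [Function.iterate_one, next, if_pos hi]
    exact ⟨rfl, fun i => (Nat.div_le_div_right (hs i)).trans hBC⟩
  · refine ⟨v + 1, le_rfl, ?_⟩
    rw [iterate_next_full h0 hi hK]
    exact ⟨rfl, fun i => (Nat.div_le_div_right (Nat.add_le_add_right (hs i) L)).trans hLC⟩

theorem next_eq_zero {s : Config v d} (hi : s.Idle) (hs : ∀ i, s.2.1 i ≤ 1) :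
    s.next L K = zero v d := by
  rw [next, if_pos hi]
  refine Prod.ext rfl (Prod.ext (funext fun i => ?_) rfl)
  exact Nat.div_eq_of_lt (Nat.lt_succ_of_le (hs i))

/-- After a block from a value `m ≤ 1` the quotient is at most 1. If it is 1, the remainder is `m +
L - 2 ^ (v + 1) < K`, so the component is flagged. Thus the next step is idle and halves everything
to zero. The hypothesis `hLK` expresses `u ≥ 1`. -/
theorem exists_iterate_eq_zero (hK : K < 2 ^ (v + 1)) (hLK : L + 2 ≤ K + 2 ^ (v + 1))
    {s : Config v d} (h0 : s.1 = 0) (hs : ∀ i, s.2.1 i ≤ 1) :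
    ∃ k ≤ v + 2, (next L K)^[k] s = zero v d := by
  by_cases hi : s.Idle
  · exact ⟨1, by omega, next_eq_zero hi hs⟩
  have hdiv : ∀ i, 2 ^ (v + 1) * ((s.2.1 i + L) / 2 ^ (v + 1)) + (s.2.1 i + L) % 2 ^ (v + 1)
      = s.2.1 i + L := fun i => Nat.div_add_mod _ _
  refine ⟨v + 2, le_rfl, ?_⟩
  rw [Function.iterate_succ_apply', iterate_next_full h0 hi hK]
  refine next_eq_zero ⟨rfl, fun i hf => ?_⟩ fun i => ?_
  · simp only [decide_eq_false_iff_not, not_lt] at hf ⊢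
    have h1 := hs i
    have h2 := hdiv i
    rcases Nat.eq_zero_or_pos ((s.2.1 i + L) / 2 ^ (v + 1)) with h | h
    · rw [h]
    · have := Nat.mul_le_mul_left (2 ^ (v + 1)) h
      omega
  · refine Nat.le_of_lt_succ (Nat.div_lt_of_lt_mul ?_)
    have := hs i
    omega

theorem iterate_next_eq_zero (hK : K < 2 ^ (v + 1)) (hLK : L + 2 ≤ K + 2 ^ (v + 1))
    {s : Config v d} (hs : ∀ i, s.2.1 i ≤ 3) :
    (next L K)^[4 * (v + 2)] s = zero v d := by
  have hpow : 2 ^ (v + 2) = 2 * 2 ^ (v + 1) := pow_succ' 2 (v + 1)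
  have htwo : 2 ≤ 2 ^ (v + 1) := by rw [pow_succ]; have := Nat.one_le_two_pow (n := v); omega
  -- Finish the current block, lower the bound from 3 to 2 and then to 1, and reach zero: at most `v
  -- + (v + 1) + (v + 1) + (v + 2)` steps.
  obtain ⟨k₁, h₁, hp₁, hs₁⟩ := exists_iterate_position_zero (L := L) (K := K) (by omega) v s (by omega) hs
  obtain ⟨k₂, h₂, hp₂, hs₂⟩ := exists_iterate_le (L := L) (C := 2) hK hp₁ hs₁ (by omega)
    (Nat.le_of_lt_succ (Nat.div_lt_of_lt_mul (by omega)))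
  obtain ⟨k₃, h₃, hp₃, hs₃⟩ := exists_iterate_le (L := L) (C := 1) hK hp₂ hs₂ (by omega)
    (Nat.le_of_lt_succ (Nat.div_lt_of_lt_mul (by omega)))
  obtain ⟨k₄, h₄, h⟩ := exists_iterate_eq_zero hK hLK hp₃ hs₃
  simp only [← Function.iterate_add_apply] at h
  obtain ⟨k, hk⟩ : ∃ k, 4 * (v + 2) = k + (k₄ + (k₃ + (k₂ + k₁))) :=
    Nat.exists_eq_add_of_le' (by omega)
  rw [hk, Function.iterate_add_apply, h, iterate_next_zero]

end Config

/-! ### The transducer as the algorithm with carries -/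

section Transducer

variable {v d L K : ℕ}

/-- The states of the transducer: configurations with carries in place of values. -/
abbrev CarryState (v d : ℕ) : Type := Fin (v + 1) × (Fin d → Fin 4) × (Fin d → Bool)

/-- The configuration of a state when the vector `e` is still to be read. -/
def CarryState.config (c : CarryState v d) (e : Fin d → ℕ) : Config v d :=
  (c.1, fun i => c.2.1 i + e i, c.2.2)

/-- The transducer that computes the Hamming weight. -/
noncomputable def weightTransducer (v d L K : ℕ) :
    Transducer (Fin d → Fin 2) (Fin 2) (CarryState v d) where
  step c a :=
    let s := (c.config fun i => (a i : ℕ)).next L K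
    (s.1, fun i => Fin.ofNat 4 (s.2.1 i), s.2.2)
  out c a := (c.config fun i => (a i : ℕ)).emit
  initial := (0, fun _ => 0, fun _ => false)
  final := {(0, fun _ => 0, fun _ => false)}

theorem CarryState.idle_config (c : CarryState v d) (a e : Fin d → ℕ) :
    (c.config fun i => a i + 2 * e i).Idle ↔ (c.config a).Idle := by
  simp only [Config.Idle, config, ← add_assoc, Nat.add_mul_mod_self_left]

theorem CarryState.emit_config (c : CarryState v d) (a e : Fin d → ℕ) :
    (c.config fun i => a i + 2 * e i).emit = (c.config a).emit := by
  classical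
  rw [Config.emit, Config.emit]
  exact if_congr (and_congr Iff.rfl (not_congr (c.idle_config a e))) rfl rfl

/-- Only the parity of a value matters in one step, so the unread part `2 * e` passes through as
`e`. The new carry is at most `(3 + 1 + 3) / 2 = 3`, so `Fin.ofNat 4` loses nothing. -/
theorem weightTransducer_step (hL : L < 2 ^ (v + 2)) (c : CarryState v d) (a : Fin d → Fin 2)
    (e : Fin d → ℕ) :
    CarryState.config ((weightTransducer v d L K).step c a) e =
      (c.config fun i => (a i : ℕ) + 2 * e i).next L K := by
  simp only [weightTransducer]
  have hg := Config.addend_le hL c.1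
  rw [Config.next, Config.next, c.idle_config]
  split_ifs
  · refine Prod.ext rfl (Prod.ext (funext fun i => ?_) rfl)
    simp only [CarryState.config, Fin.val_ofNat]
    omega
  · refine Prod.ext rfl (Prod.ext (funext fun i => ?_) (funext fun i => ?_))
    · simp only [CarryState.config, Fin.val_ofNat]
      omega
    · simp only [CarryState.config]
      congr 1
      omega

theorem binaryValue_cons (a : Fin d → Fin 2) (x : List (Fin d → Fin 2)) :
    binaryValue (a :: x) = fun i => (a i : ℕ) + 2 * binaryValue x i := by
  funext i; simp [binaryValue, Nat.ofDigits_cons]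

theorem weightTransducer_run (hL : L < 2 ^ (v + 2)) (x : List (Fin d → Fin 2))
    (c : CarryState v d) :
    CarryState.config ((weightTransducer v d L K).run c x) 0 =
      (Config.next L K)^[x.length] (c.config (binaryValue x)) := by
  induction x generalizing c with
  | nil => rfl
  | cons a x ih =>
    rw [Transducer.run, ih, weightTransducer_step hL, binaryValue_cons]; rfl

theorem weightTransducer_output (hL : L < 2 ^ (v + 2)) (x : List (Fin d → Fin 2))
    (c : CarryState v d) :
    ((weightTransducer v d L K).output c x).count 1 =
      Config.weight L K x.length (c.config (binaryValue x)) := by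
  induction x generalizing c with
  | nil => rfl
  | cons a x ih =>
    rw [Transducer.output, List.count_cons, ih, weightTransducer_step hL, binaryValue_cons,
      List.length_cons, Config.weight, c.emit_config, add_comm]
    congr 1
    simp only [weightTransducer, Config.emit]
    split_ifs <;> simp_all

theorem config_initial (e : Fin d → ℕ) :
    CarryState.config (weightTransducer v d L K).initial e = (0, e, fun _ => false) := by
  simp [CarryState.config, weightTransducer]

theorem config_eq_zero_iff (c : CarryState v d) :
    c.config 0 = Config.zero v d ↔ c = (weightTransducer v d L K).initial := by
  constructor
  · intro h
    simp only [CarryState.config, Config.zero, Prod.mk.injEq] at h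
    refine Prod.ext h.1 (Prod.ext (funext fun i => Fin.ext ?_) h.2.2)
    simpa [weightTransducer] using congrFun h.2.1 i
  · rintro rfl
    rw [config_initial]; rfl

theorem binaryValue_replicate_zero (k : ℕ) :
    binaryValue (List.replicate k (0 : Fin d → Fin 2)) = 0 := by
  induction k with
  | zero => rfl
  | succ k ih => rw [List.replicate_succ, binaryValue_cons, ih]; rfl

theorem weightTransducer_reset (hK : K < 2 ^ (v + 1)) (hLK : L + 2 ≤ K + 2 ^ (v + 1)) :
    (weightTransducer v d L K).IsResetSequenceTo (List.replicate (4 * (v + 2)) 0)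
      (weightTransducer v d L K).initial := by
  intro c
  have hpow : 2 ^ (v + 2) = 2 * 2 ^ (v + 1) := pow_succ' 2 (v + 1)
  rw [← config_eq_zero_iff, weightTransducer_run (by omega), binaryValue_replicate_zero,
    List.length_replicate]
  refine Config.iterate_next_eq_zero hK hLK fun i => ?_
  simp only [CarryState.config, Pi.zero_apply]
  omega

theorem exists_binaryValue (n : Fin d → ℕ) : ∃ x, binaryValue x = n := by
  obtain ⟨B, hB⟩ : ∃ B, ∀ i, n i < 2 ^ B :=
    ⟨∑ i, n i, fun i => (Finset.single_le_sum (fun _ _ => Nat.zero_le _)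
      (Finset.mem_univ i)).trans_lt Nat.lt_two_pow_self⟩
  induction B generalizing n with
  | zero => exact ⟨[], funext fun i => by have := hB i; simp [binaryValue]; omega⟩
  | succ B ih =>
    obtain ⟨x, hx⟩ := ih (fun i => n i / 2) fun i => by
      have := hB i; rw [pow_succ] at this; omega
    refine ⟨(fun i => ⟨n i % 2, Nat.mod_lt _ two_pos⟩) :: x, ?_⟩
    rw [binaryValue_cons, hx]
    exact funext fun i => Nat.mod_add_div _ _

/-- The algorithm terminates. -/
theorem exists_iterate_next_eq_zero (hK : K < 2 ^ (v + 1)) (hLK : L + 2 ≤ K + 2 ^ (v + 1))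
    (n : Fin d → ℕ) : ∃ N, (Config.next L K)^[N] (0, n, fun _ => false) = Config.zero v d := by
  obtain ⟨x, rfl⟩ := exists_binaryValue n
  have hpow : 2 ^ (v + 2) = 2 * 2 ^ (v + 1) := pow_succ' 2 (v + 1)
  -- Once the binary digits of `n` have been consumed, only carries below 4 remain, and the reset
  -- argument applies.
  refine ⟨4 * (v + 2) + x.length, ?_⟩
  rw [Function.iterate_add_apply, ← config_initial (L := L) (K := K),
    ← weightTransducer_run (by omega)]
  refine Config.iterate_next_eq_zero hK hLK fun i => ?_
  simp only [CarryState.config, Pi.zero_apply]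
  omega

theorem card_carryState (v d : ℕ) : Fintype.card (CarryState v d) < 8 ^ d * (v + 2) := by
  have h : Fintype.card (CarryState v d) = (v + 1) * 8 ^ d := by
    simp [← mul_pow]
  rw [h, mul_comm]
  exact Nat.mul_lt_mul_of_pos_left (Nat.lt_succ_self _) (by positivity)

end Transducer

/-! ### Splitting off the least significant columns -/

namespace JointExpansion

variable {d : ℕ}

/-- The expansion with least significant column `a` and the columns of `ε` from position `k` on. -/
noncomputable def cons (k : ℕ) (a : Fin d → ℤ) (ε : JointExpansion d) : JointExpansion d :=
  Finsupp.single 0 a + ε.mapDomain (· + k)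

/-- The columns of `ε` from position `k` on. -/
noncomputable def drop (k : ℕ) (ε : JointExpansion d) : JointExpansion d :=
  ε.comapDomain (· + k) (add_left_injective k).injOn

theorem drop_apply (k j : ℕ) (ε : JointExpansion d) : ε.drop k j = ε (j + k) := rfl

theorem cons_add {k : ℕ} (hk : 0 < k) (a : Fin d → ℤ) (ε : JointExpansion d) (j : ℕ) :
    cons k a ε (j + k) = ε j := by
  rw [cons, Finsupp.add_apply, Finsupp.single_eq_of_ne (by omega), zero_add]
  exact Finsupp.mapDomain_apply (add_left_injective k) ε j

theorem cons_of_lt {k j : ℕ} (hj : j < k) (a : Fin d → ℤ) (ε : JointExpansion d) :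
    cons k a ε j = if j = 0 then a else 0 := by
  rw [cons, Finsupp.add_apply, Finsupp.mapDomain_of_notMem_range _ _ (by
    rintro ⟨i, hi⟩; simp only at hi; omega), add_zero, Finsupp.single_apply]
  exact if_congr eq_comm rfl rfl

theorem cons_zero {k : ℕ} (hk : 0 < k) (a : Fin d → ℤ) (ε : JointExpansion d) :
    cons k a ε 0 = a := by
  rw [cons_of_lt hk, if_pos rfl]

theorem cons_drop {k : ℕ} (hk : 0 < k) (ε : JointExpansion d)
    (h : ∀ j, 0 < j → j < k → ε j = 0) : cons k (ε 0) (ε.drop k) = ε := by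
  ext1 j
  rcases lt_or_ge j k with hj | hj
  · rw [cons_of_lt hj]
    split_ifs with h0
    · rw [h0]
    · exact (h j (Nat.pos_of_ne_zero h0) hj).symm
  · obtain ⟨i, rfl⟩ := Nat.exists_eq_add_of_le' hj
    rw [cons_add hk, drop_apply]

theorem value_cons (k : ℕ) (a : Fin d → ℤ) (ε : JointExpansion d) (i : Fin d) :
    (cons k a ε).value i = a i + 2 ^ k * ε.value i := by
  change (cons k a ε).sum (fun j c => c i * 2 ^ j) = a i + 2 ^ k * ε.sum (fun j c => c i * 2 ^ j)
  rw [cons, Finsupp.sum_add_index' (by simp) (by simp [add_mul]), Finsupp.sum_single_index (by simp),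
    Finsupp.sum_mapDomain_index (by simp) (by simp [add_mul]), Finsupp.mul_sum]
  simp only [pow_zero, mul_one]
  congr 1
  exact Finsupp.sum_congr fun j _ => by ring

theorem hammingWeight_cons {k : ℕ} (hk : 0 < k) (a : Fin d → ℤ) (ε : JointExpansion d) :
    (cons k a ε).hammingWeight = (if a = 0 then 0 else 1) + ε.hammingWeight := by
  classical
  have hinj : Function.Injective (· + k) := add_left_injective k
  have hsupp := Finsupp.mapDomain_support_of_injective hinj ε
  rw [hammingWeight, cons, Finsupp.support_add_eq, hsupp, Finset.card_union_of_disjoint,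
    Finset.card_image_of_injective _ hinj]
  · congr 1
    split_ifs with h
    · simp [h]
    · simp [Finsupp.support_single, h]
  all_goals
    try rw [hsupp]
    refine Finset.disjoint_of_subset_left Finsupp.support_single_subset ?_
    simp; omega

end JointExpansion

open JointExpansion

/-! ### The conditions of the sparse form, column by column -/

variable {d v L K : ℕ} {l u : ℤ}

/-- Condition 3 for consecutive nonzero columns `a` and `b`. -/
def Compatible (l u : ℤ) (w : ℕ) (a b : Fin d → ℤ) : Prop :=
  (∃ i, Odd (b i) ∧ a i ∈ uniqueDigits l u w) ∧
  (∀ i, a i ∈ nonuniqueDigits l u w → ¬ b i ≡ u + 1 [ZMOD 2 ^ (w - 1)]) ∧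
  ∀ i, a i ∈ upperDigits l u w ∩ nonuniqueDigits l u w → b i ≡ u [ZMOD 2 ^ (w - 1)]

/-- The conditions of an asymmetric joint sparse form that concern the column at position `j` and
its successors. -/
def Admissible (l u : ℤ) (v : ℕ) (ε : JointExpansion d) (j : ℕ) : Prop :=
  (∀ i, ε j i ∈ Set.Icc l u) ∧ (ε j ≠ 0 → (∃ i, Odd (ε j i)) ∧
    (∀ k, 0 < k → k < v + 1 → ε (j + k) = 0) ∧
    (ε (j + (v + 1)) ≠ 0 → Compatible l u (v + 2) (ε j) (ε (j + (v + 1)))))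

theorem isAJSF_iff_admissible (n : Fin d → ℤ) (ε : JointExpansion d) :
    IsAJSF l u (v + 2) n ε ↔ ε.value = n ∧ ∀ j, Admissible l u v ε j := by
  constructor
  · intro h
    refine ⟨h.value_eq, fun j => ⟨h.digit_mem j, fun hj => ⟨(h.zero_or_odd j).resolve_left hj,
      fun k h1 h2 => h.sparse j hj _ (by omega) (by omega), fun hw => ?_⟩⟩⟩
    exact ⟨h.exists_odd_unique j hj hw, h.nonunique_not_modEq j hj hw,
      h.upper_nonunique_modEq j hj hw⟩
  · rintro ⟨hn, h⟩
    refine ⟨fun j => (h j).1, hn, fun j => ?_, fun j hj k h1 h2 => ?_,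
      fun j hj hw => (((h j).2 hj).2.2 hw).1, fun j hj hw => (((h j).2 hj).2.2 hw).2.1,
      fun j hj hw => (((h j).2 hj).2.2 hw).2.2⟩
    · by_cases hj : ε j = 0
      · exact Or.inl hj
      · exact Or.inr ((h j).2 hj).1
    · obtain ⟨k, rfl⟩ := Nat.exists_eq_add_of_le (show j ≤ k by omega)
      exact ((h j).2 hj).2.1 k (by omega) (by omega)

theorem admissible_of_eq_zero (hl : l ≤ 0) (hu : 0 ≤ u) {ε : JointExpansion d} {j : ℕ}
    (h : ε j = 0) : Admissible l u v ε j :=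
  ⟨fun i => by rw [h]; exact ⟨hl, hu⟩, fun hj => absurd h hj⟩

theorem admissible_cons_add {k : ℕ} (hk : 0 < k) (a : Fin d → ℤ) (ε : JointExpansion d) (j : ℕ) :
    Admissible l u v (cons k a ε) (j + k) ↔ Admissible l u v ε j := by
  simp only [Admissible, add_right_comm j k, cons_add hk]

theorem admissible_cons (hl : l ≤ 0) (hu : 0 ≤ u) {k : ℕ} (hk : 0 < k) (a : Fin d → ℤ)
    (ε : JointExpansion d) :
    (∀ j, Admissible l u v (cons k a ε) j) ↔
      Admissible l u v (cons k a ε) 0 ∧ ∀ j, Admissible l u v ε j := by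
  refine ⟨fun h => ⟨h 0, fun j => (admissible_cons_add hk a ε j).1 (h _)⟩, fun ⟨h0, h⟩ j => ?_⟩
  rcases lt_or_ge j k with hj | hj
  · rcases j.eq_zero_or_pos with rfl | hpos
    · exact h0
    · exact admissible_of_eq_zero hl hu (by rw [cons_of_lt hj, if_neg hpos.ne'])
  · obtain ⟨j, rfl⟩ := Nat.exists_eq_add_of_le' hj
    exact (admissible_cons_add hk a ε j).2 (h j)

theorem admissible_cons_zero (ε : JointExpansion d) {a : Fin d → ℤ} (ha : a ≠ 0) :
    Admissible l u v (cons (v + 1) a ε) 0 ↔ (∀ i, a i ∈ Set.Icc l u) ∧ (∃ i, Odd (a i)) ∧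
      (ε 0 ≠ 0 → Compatible l u (v + 2) a (ε 0)) := by
  have hlt : ∀ k, 0 < k → k < v + 1 → cons (v + 1) a ε (0 + k) = 0 := fun k hk hkv => by
    rw [zero_add, cons_of_lt hkv, if_neg hk.ne']
  rw [Admissible, cons_zero v.succ_pos, cons_add v.succ_pos]
  exact ⟨fun h => ⟨h.1, (h.2 ha).1, (h.2 ha).2.2⟩, fun h => ⟨h.1, fun _ => ⟨h.2.1, hlt, h.2.2⟩⟩⟩

/-! ### Digits and residues -/

theorem mem_digits_iff {M l u ρ δ K L : ℤ} (hl : l = -L) (hu : u = K + M - 1 - L)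
    (hK : K < M) (hK0 : 0 ≤ K) (hρ0 : 0 ≤ ρ) (hρ : ρ < M) :
    ρ - L + M * δ ∈ Set.Icc l u ↔ δ = 0 ∨ δ = 1 ∧ ρ < K := by
  subst hl hu
  rw [Set.mem_Icc]
  constructor
  · rintro ⟨h1, h2⟩
    have : -1 < δ := by by_contra h; nlinarith
    have : δ < 2 := by by_contra h; nlinarith
    obtain rfl | rfl : δ = 0 ∨ δ = 1 := by omega
    · exact Or.inl rfl
    · exact Or.inr ⟨rfl, by linarith⟩
  · rintro (rfl | ⟨rfl, h⟩) <;> constructor <;> linarith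

theorem mem_uniqueDigits_iff {l u ρ δ : ℤ} (hl : l = -L)
    (hu : u = K + 2 ^ (v + 1) - 1 - L) (hK : K < 2 ^ (v + 1)) (hρ0 : 0 ≤ ρ)
    (hρ : ρ < 2 ^ (v + 1)) (ha : ρ - L + 2 ^ (v + 1) * δ ∈ Set.Icc l u) :
    ρ - L + 2 ^ (v + 1) * δ ∈ uniqueDigits l u (v + 2) ↔ K ≤ ρ := by
  have hK' : (K : ℤ) < 2 ^ (v + 1) := by exact_mod_cast hK
  have h := (mem_digits_iff hl hu hK' (by positivity) hρ0 hρ).1 ha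
  have hdef : ρ - L + 2 ^ (v + 1) * δ ∈ uniqueDigits l u (v + 2) ↔
      ρ - L + 2 ^ (v + 1) * δ ∈ Set.Icc l u ∧ u - 2 ^ (v + 1) < ρ - L + 2 ^ (v + 1) * δ ∧
        ρ - L + 2 ^ (v + 1) * δ < l + 2 ^ (v + 1) := Iff.rfl
  rw [hdef]
  generalize (2 : ℤ) ^ (v + 1) = M at *
  rcases h with rfl | ⟨rfl, h⟩
  · exact ⟨fun h => by linarith [h.2.1], fun h => ⟨ha, by linarith, by linarith⟩⟩
  · exact ⟨fun h => by linarith [h.2.2], fun h => by linarith⟩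

theorem mem_nonuniqueDigits_iff {l u ρ δ : ℤ} (hl : l = -L)
    (hu : u = K + 2 ^ (v + 1) - 1 - L) (hK : K < 2 ^ (v + 1)) (hρ0 : 0 ≤ ρ)
    (hρ : ρ < 2 ^ (v + 1)) (ha : ρ - L + 2 ^ (v + 1) * δ ∈ Set.Icc l u) :
    ρ - L + 2 ^ (v + 1) * δ ∈ nonuniqueDigits l u (v + 2) ↔ ρ < K := by
  rw [nonuniqueDigits, Set.mem_sdiff, mem_uniqueDigits_iff hl hu hK hρ0 hρ ha, not_le]
  exact and_iff_right ha

theorem mem_upper_nonuniqueDigits_iff {l u ρ δ : ℤ} (hl : l = -L)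
    (hu : u = K + 2 ^ (v + 1) - 1 - L) (hK : K < 2 ^ (v + 1)) (hρ0 : 0 ≤ ρ)
    (hρ : ρ < 2 ^ (v + 1)) (ha : ρ - L + 2 ^ (v + 1) * δ ∈ Set.Icc l u) :
    ρ - L + 2 ^ (v + 1) * δ ∈ upperDigits l u (v + 2) ∩ nonuniqueDigits l u (v + 2) ↔ δ = 1 := by
  have hK' : (K : ℤ) < 2 ^ (v + 1) := by exact_mod_cast hK
  have h := (mem_digits_iff hl hu hK' (by positivity) hρ0 hρ).1 ha
  have hdef : ρ - L + 2 ^ (v + 1) * δ ∈ upperDigits l u (v + 2) ↔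
      ρ - L + 2 ^ (v + 1) * δ ∈ Set.Icc l u ∧ u - 2 ^ (v + 1) < ρ - L + 2 ^ (v + 1) * δ ∧
        ρ - L + 2 ^ (v + 1) * δ ≤ u := Iff.rfl
  rw [Set.mem_inter_iff, mem_nonuniqueDigits_iff hl hu hK hρ0 hρ ha, hdef]
  generalize (2 : ℤ) ^ (v + 1) = M at *
  rcases h with rfl | ⟨rfl, h⟩
  · simp only [zero_ne_one, iff_false, not_and, not_lt]
    intro h; linarith [h.2.1]
  · exact ⟨fun _ => rfl, fun _ => ⟨⟨ha, by linarith, ha.2⟩, h⟩⟩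

/-- The residue that is represented by the next digit, if `b` is the flag of the preceding one. -/
theorem exists_residue {M m : ℕ} (hM : 0 < M) (_ : K < M) {b : Bool} (hb : b = true → 0 < K) :
    ∃ ρ : ℤ, 0 ≤ ρ ∧ ρ < M ∧ (ρ < K ↔ (m + L) % M < K + b.toNat) ∧
      (b = true → ρ ≠ K) ∧
      ((M : ℤ) * ((m + L) / M : ℕ) + ρ = m + L ∧ (b = true → (m + L) % M ≠ K) ∨
        b = true ∧ ρ = K - 1 ∧ (M : ℤ) * ((m + L) / M : ℕ) + ρ = m + L - 1) := by
  have hlt := Nat.mod_lt (m + L) hM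
  have heq : (M : ℤ) * ((m + L) / M : ℕ) + ((m + L) % M : ℕ) = m + L := by
    exact_mod_cast Nat.div_add_mod (m + L) M
  -- The residue is changed only here, from `K` to `K - 1`; since `K > 0`, the quotient stays the
  -- same.
  by_cases h : b = true ∧ (m + L) % M = K
  · have := hb h.1
    refine ⟨K - 1, by omega, by omega, ?_, fun _ => by omega, Or.inr ⟨h.1, rfl, ?_⟩⟩
    · rw [h.1, h.2, Bool.toNat_true]; omega
    · rw [h.2] at heq; linarith
  · rw [not_and] at h
    refine ⟨((m + L) % M : ℕ), by omega, by omega, ?_, fun hb => by have := h hb; omega,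
      Or.inl ⟨heq, h⟩⟩
    cases b
    · rw [Bool.toNat_false]; omega
    · have := h rfl
      rw [Bool.toNat_true]; omega

theorem eq_of_dvd_sub {M a b : ℤ} (ha0 : 0 ≤ a) (ha : a < M) (hb0 : 0 ≤ b) (hb : b < M)
    (h : M ∣ b - a) : a = b := by
  have := (Int.modEq_iff_dvd.2 h).eq
  rwa [Int.emod_eq_of_lt ha0 ha, Int.emod_eq_of_lt hb0 hb] at this

/-- The digit `a` is admissible after a column whose flag is `b` if the tentative value is `m`, and
leaves the value `n`. -/
def DigitStep (u : ℤ) (v : ℕ) (m : ℕ) (b : Bool) (a n : ℤ) : Prop :=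
  (a + 2 ^ (v + 1) * n = m ∨ b = true ∧ a + 2 ^ (v + 1) * n = m - 1) ∧
  (b = true → ¬ a ≡ u + 1 [ZMOD 2 ^ (v + 1)]) ∧
  (b = true → a + 2 ^ (v + 1) * n = m - 1 → a ≡ u [ZMOD 2 ^ (v + 1)])

/-- Uniqueness half: the admissible digit must use the same one of `m` and `m - 1` as the algorithm,
so its residue is forced and only the multiple of `2 ^ (v + 1)` is free. -/
theorem DigitStep.exists_residue {m : ℕ} {b : Bool} {a n : ℤ} (hu : u = K + 2 ^ (v + 1) - 1 - L)
    (hK : K < 2 ^ (v + 1)) (hb : b = true → 0 < K) (h : DigitStep u v m b a n) :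
    ∃ ρ : ℤ, 0 ≤ ρ ∧ ρ < 2 ^ (v + 1) ∧
      (ρ < K ↔ (m + L) % 2 ^ (v + 1) < K + b.toNat) ∧
      a = ρ - L + 2 ^ (v + 1) * (((m + L) / 2 ^ (v + 1) : ℕ) - n) := by
  obtain ⟨ρ, h0, hlt, hiff, hρK, hρ⟩ := _root_.exists_residue (L := L) (m := m) (by positivity) hK hb
  rw [Nat.cast_pow, Nat.cast_ofNat] at hlt hρ
  refine ⟨ρ, h0, hlt, hiff, ?_⟩
  have hK' : (K : ℤ) < 2 ^ (v + 1) := by exact_mod_cast hK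
  obtain ⟨heq, hne, hlow⟩ := h
  generalize (((m + L) / 2 ^ (v + 1) : ℕ) : ℤ) = q at *
  generalize (2 : ℤ) ^ (v + 1) = M at *
  rcases hρ with ⟨hρ, -⟩ | ⟨hb', rfl, hρ⟩
  · rcases heq with heq | ⟨hb', heq⟩
    -- If the digit used `m - 1` although the algorithm keeps `m`, then `a ≡ u` would force `ρ = K`.
    · linarith
    · obtain ⟨k, hk⟩ := (hlow hb' heq).dvd
      refine absurd ?_ (hρK hb')
      refine eq_of_dvd_sub h0 hlt (by positivity) hK' ⟨k - 1 - n + q, ?_⟩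
      subst hu; linarith
  · rcases heq with heq | ⟨-, heq⟩
    -- If the digit used `m` although its residue is `K`, then `a ≡ u + 1`, which is forbidden.
    · refine absurd (Int.modEq_iff_dvd.2 ⟨1 + n - q, ?_⟩) (hne hb')
      subst hu; linarith
    · linarith

/-- Existence half: the remaining value `n` is prescribed by the tail, and `δ` is whatever it leaves
over. The value `δ = 1` occurs only when the residue is nonunique, so the digit stays in range. -/
theorem exists_digitStep {m : ℕ} {b : Bool} (hl : l = -L) (hu : u = K + 2 ^ (v + 1) - 1 - L)
    (hK : K < 2 ^ (v + 1)) (hb : b = true → 0 < K) {n : ℤ}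
    (hn : n = ((m + L) / 2 ^ (v + 1) : ℕ) ∨
      (m + L) % 2 ^ (v + 1) < K + b.toNat ∧ n = ((m + L) / 2 ^ (v + 1) : ℕ) - 1) :
    ∃ ρ δ : ℤ, 0 ≤ ρ ∧ ρ < 2 ^ (v + 1) ∧
      (ρ < K ↔ (m + L) % 2 ^ (v + 1) < K + b.toNat) ∧
      n = ((m + L) / 2 ^ (v + 1) : ℕ) - δ ∧ ρ - L + 2 ^ (v + 1) * δ ∈ Set.Icc l u ∧
      DigitStep u v m b (ρ - L + 2 ^ (v + 1) * δ) n := by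
  obtain ⟨ρ, h0, hlt, hiff, hρK, hρ⟩ := _root_.exists_residue (L := L) (m := m) (by positivity) hK hb
  rw [Nat.cast_pow, Nat.cast_ofNat] at hlt hρ
  have hK' : (K : ℤ) < 2 ^ (v + 1) := by exact_mod_cast hK
  rw [← hiff] at hn
  refine ⟨ρ, ((m + L) / 2 ^ (v + 1) : ℕ) - n, h0, hlt, hiff, by ring, ?_⟩
  rw [DigitStep]
  generalize (((m + L) / 2 ^ (v + 1) : ℕ) : ℤ) = q at *
  generalize (2 : ℤ) ^ (v + 1) = M at *
  refine ⟨(mem_digits_iff hl hu hK' (by positivity) h0 hlt).2 ?_, ?_, fun hb' h => ?_,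
    fun hb' h => ?_⟩
  · rcases hn with rfl | ⟨hρ, rfl⟩
    · left; ring
    · right; exact ⟨by ring, hρ⟩
  · rcases hρ with ⟨hρ, -⟩ | ⟨hb', -, hρ⟩
    · left; linarith
    · right; exact ⟨hb', by linarith⟩
  · obtain ⟨k, hk⟩ := h.dvd
    refine hρK hb' (eq_of_dvd_sub h0 hlt (by positivity) hK' ⟨k - 1 + (q - n), ?_⟩)
    subst hu; linarith
  · rcases hρ with ⟨hρ, -⟩ | ⟨-, rfl, hρ⟩
    · linarith
    · refine Int.modEq_iff_dvd.2 ⟨1 - (q - n), ?_⟩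
      subst hu; linarith

/-! ### Tails follow the algorithm -/

/-- The expansion `ε` continues an asymmetric joint sparse form after a column whose flags are `f`
if the tentative values are `m`. -/
def IsTail (l u : ℤ) (v : ℕ) (m : Fin d → ℕ) (f : Fin d → Bool) (ε : JointExpansion d) : Prop :=
  (∀ j, Admissible l u v ε j) ∧
  (∀ i, ε.value i = m i ∨ f i = true ∧ ε.value i = m i - 1) ∧
  (ε 0 ≠ 0 → (∃ i, Odd (ε 0 i) ∧ f i = false) ∧
    (∀ i, f i = true → ¬ ε 0 i ≡ u + 1 [ZMOD 2 ^ (v + 1)]) ∧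
    ∀ i, f i = true → ε.value i = m i - 1 → ε 0 i ≡ u [ZMOD 2 ^ (v + 1)])

theorem isAJSF_iff_isTail (m : Fin d → ℕ) (ε : JointExpansion d) :
    IsAJSF l u (v + 2) (fun i => (m i : ℤ)) ε ↔ IsTail l u v m (fun _ => false) ε := by
  rw [isAJSF_iff_admissible, IsTail]
  constructor
  · rintro ⟨hn, h⟩
    refine ⟨h, fun i => Or.inl (congrFun hn i), fun h0 => ?_⟩
    obtain ⟨i, hi⟩ := ((h 0).2 h0).1
    exact ⟨⟨i, hi, rfl⟩, by simp, by simp⟩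
  · rintro ⟨h, hn, -⟩
    exact ⟨funext fun i => by simpa using hn i, h⟩

theorem value_eq_drop {k : ℕ} (hk : 0 < k) {ε : JointExpansion d}
    (h : ∀ j, 0 < j → j < k → ε j = 0) (i : Fin d) :
    ε.value i = ε 0 i + 2 ^ k * (ε.drop k).value i := by
  conv_lhs => rw [← cons_drop hk ε h]
  exact value_cons _ _ _ _

/-- A nonzero column would need an odd digit in an unflagged component, whose value is even. After
the zero column, the even one of `m` and `m - 1` has half `m / 2`, and condition 3 no longer links
to the earlier column, so the flags are cleared. -/
theorem isTail_of_idle (hl : l ≤ 0) (hu : 0 ≤ u) {m : Fin d → ℕ} {f : Fin d → Bool}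
    (hm : ∀ i, f i = false → m i % 2 = 0) (ε : JointExpansion d) :
    IsTail l u v m f ε ↔
      ∃ ε', ε = cons 1 0 ε' ∧ IsTail l u v (fun i => m i / 2) (fun _ => false) ε' := by
  constructor
  · rintro ⟨h, hn, hε⟩
    have hval : ∀ i, ε.value i = ε 0 i + 2 ^ 1 * (ε.drop 1).value i :=
      value_eq_drop one_pos (by omega)
    have h0 : ε 0 = 0 := by
      by_contra h0
      obtain ⟨⟨i, ⟨c, hc⟩, hi⟩, -⟩ := hε h0
      have h1 := hval i
      have h2 := hn i
      have h3 := hm i hi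
      simp only [hi, Bool.false_eq_true, false_and, or_false] at h2
      omega
    have hε' : ε = cons 1 0 (ε.drop 1) := by
      conv_rhs => rw [← h0]
      exact (cons_drop one_pos ε (by omega)).symm
    refine ⟨ε.drop 1, hε', ?_⟩
    rw [← isAJSF_iff_isTail, isAJSF_iff_admissible]
    rw [hε', admissible_cons hl hu one_pos] at h
    refine ⟨funext fun i => ?_, h.2⟩
    have h1 := hval i
    have h3 := hm i
    rw [h0, Pi.zero_apply] at h1
    cases hf : f i <;> simp only [hf] at h3 <;> have h2 := hn i <;> simp [hf] at h2 <;> omega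
  · rintro ⟨ε', rfl, h⟩
    rw [← isAJSF_iff_isTail, isAJSF_iff_admissible] at h
    have h0 : cons 1 0 ε' 0 = 0 := cons_zero one_pos _ _
    refine ⟨(admissible_cons hl hu one_pos _ _).2 ⟨admissible_of_eq_zero hl hu h0, h.2⟩,
      fun i => ?_, fun h => absurd h0 h⟩
    rw [value_cons, h.1]
    have h3 := hm i
    cases hf : f i <;> simp [hf] at h3 ⊢ <;> omega

/-- The flags after a block. -/
def blockFlags (v L K : ℕ) (m : Fin d → ℕ) (f : Fin d → Bool) (i : Fin d) : Bool :=
  decide ((m i + L) % 2 ^ (v + 1) < K + (f i).toNat)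

/-- An odd unflagged value forces a nonzero column, hence a full block. The forced residues turn
condition 3 for this column into the flag conditions on the tail, with `δ = 1` meaning that the tail
has value one less than tentative. -/
theorem IsTail.exists_cons (hl : l = -L) (hu : u = K + 2 ^ (v + 1) - 1 - L) (hu0 : 0 ≤ u)
    (hK : K < 2 ^ (v + 1)) {m : Fin d → ℕ} {f : Fin d → Bool} (hf : ∀ i, f i = true → 0 < K)
    (hm : ∃ i, f i = false ∧ m i % 2 = 1) {ε : JointExpansion d} (h : IsTail l u v m f ε) :
    ∃ a ε', a ≠ 0 ∧ ε = cons (v + 1) a ε' ∧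
      IsTail l u v (fun i => (m i + L) / 2 ^ (v + 1)) (blockFlags v L K m f) ε' := by
  have hl0 : l ≤ 0 := by omega
  obtain ⟨had, hn, hint⟩ := h
  have h0 : ε 0 ≠ 0 := by
    intro h0
    obtain ⟨i, hi, hodd⟩ := hm
    have h1 : ε.value i = ε 0 i + 2 ^ 1 * (ε.drop 1).value i :=
      value_eq_drop one_pos (by omega) i
    have h2 := hn i
    simp only [hi, Bool.false_eq_true, false_and, or_false] at h2
    rw [h0, Pi.zero_apply] at h1
    omega
  obtain ⟨hodd, hne, hlow⟩ := hint h0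
  have hzero : ∀ j, 0 < j → j < v + 1 → ε j = 0 := fun j hj hjv => by
    simpa using ((had 0).2 h0).2.1 j hj hjv
  have hval := value_eq_drop v.succ_pos hzero
  have hcons := cons_drop v.succ_pos ε hzero
  rw [← hcons, admissible_cons hl0 hu0 v.succ_pos, admissible_cons_zero _ h0] at had
  obtain ⟨⟨hmem, -, hcomp⟩, had⟩ := had
  refine ⟨ε 0, ε.drop (v + 1), h0, hcons.symm, had, fun i => ?_, fun hw => ?_⟩
  all_goals
    have hstep : ∀ i, DigitStep u v (m i) (f i) (ε 0 i) ((ε.drop (v + 1)).value i) := fun i => by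
      have h1 := hn i
      have h2 := hlow i
      rw [hval] at h1 h2
      exact ⟨h1, hne i, h2⟩
    have hres := fun i => (hstep i).exists_residue hu hK (hf i)
    simp only [blockFlags, decide_eq_true_eq, decide_eq_false_iff_not]
  · obtain ⟨ρ, hρ0, hρ, hiff, ha⟩ := hres i
    have hmem := hmem i
    rw [ha, mem_digits_iff hl hu (by exact_mod_cast hK) (by positivity) hρ0 hρ] at hmem
    rw [← hiff]
    rcases hmem with h | ⟨h, hρK⟩
    · left; linarith
    · right; exact ⟨hρK, by linarith⟩
  · obtain ⟨⟨i, hi, hui⟩, h2, h3⟩ := hcomp hw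
    refine ⟨⟨i, hi, ?_⟩, fun i hi => h2 i ?_, fun i hi hv => h3 i ?_⟩ <;>
    obtain ⟨ρ, hρ0, hρ, hiff, ha⟩ := hres i <;> have hmem := hmem i
    · rw [ha] at hui hmem
      rw [← hiff, not_lt]
      exact (mem_uniqueDigits_iff hl hu hK hρ0 hρ hmem).1 hui
    · rw [ha] at hmem ⊢
      exact (mem_nonuniqueDigits_iff hl hu hK hρ0 hρ hmem).2 (hiff.2 hi)
    · rw [ha] at hmem ⊢
      exact (mem_upper_nonuniqueDigits_iff hl hu hK hρ0 hρ hmem).2 (by linarith)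

theorem IsTail.cons_of_block (hl : l = -L) (hu : u = K + 2 ^ (v + 1) - 1 - L) (hu0 : 0 ≤ u)
    (hK : K < 2 ^ (v + 1)) {m : Fin d → ℕ} {f : Fin d → Bool} (hf : ∀ i, f i = true → 0 < K)
    (hm : ∃ i, f i = false ∧ m i % 2 = 1) {ε : JointExpansion d}
    (h : IsTail l u v (fun i => (m i + L) / 2 ^ (v + 1)) (blockFlags v L K m f) ε) :
    ∃ a, a ≠ 0 ∧ IsTail l u v m f (cons (v + 1) a ε) := by
  have hl0 : l ≤ 0 := by omega
  obtain ⟨had, hn, hint⟩ := h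
  simp only [blockFlags, decide_eq_true_eq, decide_eq_false_iff_not] at hn hint
  choose ρ δ hρ0 hρ hiff hδ hmem hstep using fun i =>
    exists_digitStep hl hu hK (hf i) (hn i)
  have hodd : ∃ i, Odd (ρ i - L + 2 ^ (v + 1) * δ i) ∧ f i = false := by
    obtain ⟨i, hi, hodd⟩ := hm
    refine ⟨i, ?_, hi⟩
    have h1 := (hstep i).1
    simp only [hi, Bool.false_eq_true, false_and, or_false] at h1
    -- The power of 2 is even, so the digit has the parity of `m i`.
    rw [pow_succ', mul_assoc 2 _ (ε.value i)] at h1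
    rw [pow_succ', Int.odd_iff]
    omega
  have ha0 : (fun i => ρ i - L + 2 ^ (v + 1) * δ i) ≠ 0 := fun h0 => by
    obtain ⟨i, hi, -⟩ := hodd
    rw [congrFun h0 i] at hi
    simp at hi
  refine ⟨_, ha0, (admissible_cons hl0 hu0 v.succ_pos _ _).2 ⟨(admissible_cons_zero _ ha0).2
    ⟨hmem, hodd.imp fun i => And.left, fun hw => ?_⟩, had⟩, fun i => ?_, fun _ => ?_⟩
  · obtain ⟨⟨i, hi, hui⟩, h2, h3⟩ := hint hw
    refine ⟨⟨i, hi, ?_⟩, fun i hi => h2 i ?_, fun i hi => ?_⟩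
    · rw [← hiff, not_lt] at hui
      exact (mem_uniqueDigits_iff hl hu hK (hρ0 i) (hρ i) (hmem i)).2 hui
    · exact (hiff i).1 ((mem_nonuniqueDigits_iff hl hu hK (hρ0 i) (hρ i) (hmem i)).1 hi)
    · have h4 := (hiff i).1 ((mem_nonuniqueDigits_iff hl hu hK (hρ0 i) (hρ i) (hmem i)).1 hi.2)
      have h5 := (mem_upper_nonuniqueDigits_iff hl hu hK (hρ0 i) (hρ i) (hmem i)).1 hi
      exact h3 i h4 (by rw [hδ i, h5])
  · rw [value_cons]; exact (hstep i).1
  · rw [cons_zero v.succ_pos]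
    refine ⟨hodd, fun i => (hstep i).2.1, fun i hi hv => (hstep i).2.2 hi ?_⟩
    rwa [value_cons] at hv

theorem isTail_zero_iff (hl : l ≤ 0) (hu : 0 ≤ u) (ε : JointExpansion d) :
    IsTail l u v (fun _ => 0) (fun _ => false) ε ↔ ε = 0 := by
  constructor
  · intro h
    ext1 j
    induction j generalizing ε with
    | zero =>
      obtain ⟨ε', rfl, -⟩ := (isTail_of_idle hl hu (fun _ _ => rfl) ε).1 h
      exact cons_zero one_pos _ _
    | succ j ih =>
      obtain ⟨ε', rfl, h'⟩ := (isTail_of_idle hl hu (fun _ _ => rfl) ε).1 h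
      rw [cons_add one_pos]
      exact ih ε' h'
  · rintro rfl
    rw [← isAJSF_iff_isTail, isAJSF_iff_admissible]
    exact ⟨by ext; simp [value], fun j => admissible_of_eq_zero hl hu rfl⟩

/-! ### The weight and the main theorem -/

open Config

/-- If the algorithm terminates, then the number of nonzero columns that it finds is the Hamming
weight of every continuation, and there is a continuation. -/
theorem isTail_weight (hl : l = -L) (hu : u = K + 2 ^ (v + 1) - 1 - L) (hu0 : 0 ≤ u)
    (hK : K < 2 ^ (v + 1)) (N : ℕ) (m : Fin d → ℕ) (f : Fin d → Bool)
    (hf : ∀ i, f i = true → 0 < K)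
    (hN : (next L K)^[N] ((0, m, f) : Config v d) = zero v d) :
    (∃ ε, IsTail l u v m f ε) ∧
      ∀ ε, IsTail l u v m f ε → weight L K N ((0, m, f) : Config v d) = ε.hammingWeight := by
  have hl0 : l ≤ 0 := by omega
  induction N using Nat.strong_induction_on generalizing m f with
  | _ N ih =>
  rcases N.eq_zero_or_pos with rfl | hpos
  · simp only [Function.iterate_zero, id, zero, Prod.mk.injEq, true_and] at hN
    obtain ⟨rfl, rfl⟩ := hN
    refine ⟨⟨0, (isTail_zero_iff hl0 hu0 _).2 rfl⟩, fun ε hε => ?_⟩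
    rw [(isTail_zero_iff hl0 hu0 _).1 hε]
    rfl
  by_cases hidle : Idle ((0, m, f) : Config v d)
  · obtain ⟨N, rfl⟩ := Nat.exists_eq_succ_of_ne_zero hpos.ne'
    have hnext : next L K ((0, m, f) : Config v d) = (0, fun i => m i / 2, fun _ => false) := by
      rw [next, if_pos hidle]
    rw [Function.iterate_succ_apply, hnext] at hN
    obtain ⟨⟨ε, hε⟩, hw⟩ := ih N (Nat.lt_succ_self N) _ _ (by simp) hN
    refine ⟨⟨cons 1 0 ε, (isTail_of_idle hl0 hu0 hidle.2 _).2 ⟨ε, rfl, hε⟩⟩, fun ε hε => ?_⟩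
    obtain ⟨ε', rfl, hε'⟩ := (isTail_of_idle hl0 hu0 hidle.2 _).1 hε
    rw [weight, hnext, hw ε' hε', hammingWeight_cons one_pos, if_pos rfl, emit, if_neg (by tauto)]
    rfl
  · have hm : ∃ i, f i = false ∧ m i % 2 = 1 := by
      by_contra h
      push Not at h
      exact hidle ⟨rfl, fun i hi => (Nat.mod_two_eq_zero_or_one (m i)).resolve_right (h i hi)⟩
    -- Inside a block the position is nonzero, so the zero configuration is not reached before the
    -- block ends.
    have hNv : v + 1 ≤ N := by
      by_contra hlt
      rw [iterate_next_block rfl hidle N (by omega)] at hN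
      have := congrArg (fun s => (s.1 : ℕ)) hN
      simp only [zero, Fin.val_ofNat, Nat.mod_eq_of_lt (show N < v + 1 by omega),
        Fin.val_zero] at this
      omega
    obtain ⟨N, rfl⟩ := Nat.exists_eq_add_of_le hNv
    have hfull := iterate_next_full (L := L) (s := ((0, m, f) : Config v d)) rfl hidle hK
    rw [add_comm, Function.iterate_add_apply, hfull] at hN
    have hf' : ∀ i, blockFlags v L K m f i = true → 0 < K := fun i hi => by
      by_cases hfi : f i = true
      · exact hf i hfi
      · simp only [blockFlags, Bool.not_eq_true] at hi hfi
        rw [hfi, Bool.toNat_false, decide_eq_true_eq] at hi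
        omega
    obtain ⟨⟨ε, hε⟩, hw⟩ := ih N (by omega) _ _ hf' hN
    refine ⟨?_, fun ε hε => ?_⟩
    · obtain ⟨a, -, ha⟩ := hε.cons_of_block hl hu hu0 hK hf hm
      exact ⟨_, ha⟩
    · obtain ⟨a, ε', ha, rfl, hε'⟩ := hε.exists_cons hl hu hu0 hK hf hm
      rw [weight_add, weight_full rfl hidle, hfull, hammingWeight_cons v.succ_pos, if_neg ha,
        ← hw ε' hε']
      rfl

theorem mainTheorem2 (d : ℕ) (l u : ℤ) (hl : l ≤ 0) (hu : 1 ≤ u)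
    (w : ℕ) (hw₁ : 2 ^ (w - 1) ≤ u - l + 1) (hw₂ : u - l + 1 < 2 ^ w) :
    ∃ (σ : Type) (_ : Fintype σ) (T : Transducer (Fin d → Fin 2) (Fin 2) σ),
      Fintype.card σ < 8 ^ d * w ∧
      T.final = {T.initial} ∧
      (∀ n : Fin d → ℕ,
        (∃ ε : JointExpansion d, IsAJSF l u w (fun i => (n i : ℤ)) ε) ∧
        ∀ ε : JointExpansion d, IsAJSF l u w (fun i => (n i : ℤ)) ε →
          ∀ x : List (Fin d → Fin 2), binaryValue x = n →
            T.run T.initial x ∈ T.final →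
              (T.output T.initial x).count 1 = ε.hammingWeight) ∧
      T.IsResetSequenceTo (List.replicate (4 * w) 0) T.initial := by
  obtain ⟨v, rfl⟩ : ∃ v, w = v + 2 := by
    rcases w with - | - | v
    · rw [pow_zero] at hw₂; omega
    · rw [zero_add, pow_one] at hw₂; omega
    · exact ⟨v, rfl⟩
  rw [show v + 2 - 1 = v + 1 from rfl] at hw₁
  have hpow : (2 : ℤ) ^ (v + 2) = 2 * 2 ^ (v + 1) := pow_succ' 2 (v + 1)
  have hpow' : 2 ^ (v + 2) = 2 * 2 ^ (v + 1) := pow_succ' 2 (v + 1)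
  have hcast : ((2 ^ (v + 1) : ℕ) : ℤ) = 2 ^ (v + 1) := by push_cast; rfl
  obtain ⟨L, hL⟩ : ∃ L : ℕ, l = -L := ⟨l.natAbs, by omega⟩
  -- `K` counts the residue classes that contain two digits.
  obtain ⟨K, hK⟩ : ∃ K : ℕ, u = K + 2 ^ (v + 1) - 1 - L :=
    ⟨(u - l + 1 - 2 ^ (v + 1)).toNat, by omega⟩
  have hKlt : K < 2 ^ (v + 1) := by omega
  have hLK : L + 2 ≤ K + 2 ^ (v + 1) := by omega
  refine ⟨CarryState v d, inferInstance, weightTransducer v d L K, card_carryState v d, rfl,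
    fun n => ⟨?_, ?_⟩, weightTransducer_reset hKlt hLK⟩
  · simp only [isAJSF_iff_isTail]
    obtain ⟨N, hN⟩ := exists_iterate_next_eq_zero hKlt hLK n
    exact (isTail_weight hL hK (by omega) hKlt N n _ (by simp) hN).1
  · rintro ε hε x rfl hx
    have hfin : (weightTransducer v d L K).run (weightTransducer v d L K).initial x =
      (weightTransducer v d L K).initial := hx
    rw [← config_eq_zero_iff, weightTransducer_run (by omega), config_initial] at hfin
    rw [isAJSF_iff_isTail] at hε
    rw [weightTransducer_output (by omega), config_initial]
    exact (isTail_weight hL hK (by omega) hKlt _ _ _ (by simp) hfin).2 ε hε
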